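/- Let $A,B_1,\dots,B_m\in\mathbb R^{n\times n}$ and let $\Omega\subset\mathbb R^m$ be compact. Let $\mathcal U$ be the set of all $u\in L^\infty(\mathbb R,\mathbb R^m)$ with $u(t)\in\Omega$ for almost all $t$. Consider the homogeneous bilinear control system $$\dot x(t)=Ax(t)+\sum_{i=1}^m u_i(t)B_ix(t),\qquad u\in\mathcal U,$$ on $\mathbb R^n$, with (Carathéodory) solutions $\varphi(t,x,u)$, $t\in\mathbb R$, $\varphi(0,x,u)=x$, and the induced system on the Euclidean unit sphere $\mathbb S^{n-1}$, $$\dot s(t)=h_0(s(t))+\sum_{i=1}^m u_i(t)h_i(s(t)),\qquad h_0(s)=As-(s^\top As)\,s,\quad h_i(s)=B_is-(s^\top B_is)\,s .$$ For a control system with controls in $\mathcal U$ on a state space $M$ (here $M=\mathbb R^n$ or $M=\mathbb S^{n-1}$) with solutions $\psi(t,x,u)$, and for $x\in M$, $T>0$, put $$\mathcal O^+_{\le T}(x)=\{\psi(t,x,u) : 0\le t\le T,\ u\in\mathcal U\},\qquad \mathcal O^-_{\le T}(x)=\{y\in M : x=\psi(t,y,u)\text{ for some }0\le t\le T,\ u\in\mathcal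 U\},$$ and $\mathcal O^+(x)=\bigcup_{T>0}\mathcal O^+_{\le T}(x)$. The system is locally accessible in $x$ if $\mathcal O^+_{\le T}(x)$ and $\mathcal O^-_{\le T}(x)$ have nonvoid interior in $M$ for all $T>0$. A nonvoid set $D\subset M$ is a control set if (a) for every $x\in D$ there is $u\in\mathcal U$ with $\psi(t,x,u)\in D$ for all $t\ge 0$, (b) $D\subset\overline{\mathcal O^+(x)}$ for every $x\in D$, and (c) $D$ is maximal with these properties, that is, every $D'\supset D$ satisfying (a) and (b) equals $D$. **Theorem.** Let ${}_{\mathbb S}D$ be a control set with nonvoid interior for the system on $\mathbb S^{n-1}$ and suppose that (i) the system on $\mathbb S^{n-1}$ is locally accessible in every point of $\mathrm{int}({}_{\mathbb S}D)$; (ii) there are $\alpha_0^+>1$, $\delta_0>0$ and $\alpha^-\in(0,1)$ such that for all $\alpha^+\in(\alpha_0^+,\alpha_0^++\delta_0)$ there are points $s^+,s^-\in\mathrm{int}({}_{\mathbb S}D)$, controls $u^+,u^-\in\mathcal U$ and times $\sigma^+,\sigma^->0$ with $$\varphi(\sigma^+,s^+,u^+)=\alpha^+s^+,\qquad \varphi(\sigma^-,s^-,u^-)=\alpha^-s^-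 .$$ Then the cone $\{\alpha s\in\mathbb R^n : \alpha>0,\ s\in{}_{\mathbb S}D\}$ is a control set with nonvoid interior for the bilinear system on $\mathbb R^n$. -/

import Mathlib

open Set MeasureTheory

noncomputable section

/-- A control-affine system `ẋ = f₀(x) + ∑ i, uᵢ(t) fᵢ(x)`, `u(t) ∈ Ω`, whose state space `M` is
embedded by `ι` in a vector space `E`. The vector fields are given through their values in `E`
(tangent vectors of `M` are regarded as vectors of `E`). -/
structure ControlAffineSystem (m : ℕ) (M E : Type*) where
  /-- the embedding of the state space -/
  ι : M → E
  /-- the drift vector field -/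
  f₀ : M → E
  /-- the controlled vector fields -/
  f : Fin m → M → E
  /-- the control range -/
  Ω : Set (EuclideanSpace ℝ (Fin m))

namespace ControlAffineSystem

variable {m : ℕ} {M E : Type*} [TopologicalSpace M] [NormedAddCommGroup E] [NormedSpace ℝ E]

/-- The admissible controls: `u ∈ L^∞(ℝ, ℝ^m)` with `u(t) ∈ Ω` for almost all `t`. -/
def Admissible (S : ControlAffineSystem m M E) (u : ℝ → EuclideanSpace ℝ (Fin m)) : Prop :=
  MemLp u ⊤ volume ∧ ∀ᵐ t ∂(volume : Measure ℝ), u t ∈ S.Ω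

/-- The right-hand side `f₀(x) + ∑ i, vᵢ fᵢ(x)` for the control value `v`. -/
def rhs (S : ControlAffineSystem m M E) (v : EuclideanSpace ℝ (Fin m)) (x : M) : E :=
  S.f₀ x + ∑ i, v i • S.f i x

/-- `x : ℝ → M` is a (Carathéodory) solution for the control `u`, written as an integral equation. -/
def IsSolution (S : ControlAffineSystem m M E) (u : ℝ → EuclideanSpace ℝ (Fin m)) (x : ℝ → M) :
    Prop :=
  Continuous x ∧ ∀ t : ℝ, S.ι (x t) = S.ι (x 0) + ∫ τ in (0 : ℝ)..t, S.rhs (u τ) (x τ)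

/-- `S.Steers u t x y` says `φ(t, x, u) = y`: the solution for the control `u` that starts in `x` at
time `0` is in `y` at time `t`. -/
def Steers (S : ControlAffineSystem m M E) (u : ℝ → EuclideanSpace ℝ (Fin m)) (t : ℝ) (x y : M) :
    Prop :=
  ∃ ξ : ℝ → M, S.IsSolution u ξ ∧ ξ 0 = x ∧ ξ t = y

/-- The set of points reachable from `x` up to time `T`. -/
def posOrbitLE (S : ControlAffineSystem m M E) (T : ℝ) (x : M) : Set M :=
  {y | ∃ t, 0 ≤ t ∧ t ≤ T ∧ ∃ u, S.Admissible u ∧ S.Steers u t x y}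

/-- The set of points controllable to `x` up to time `T`. -/
def negOrbitLE (S : ControlAffineSystem m M E) (T : ℝ) (x : M) : Set M :=
  {y | ∃ t, 0 ≤ t ∧ t ≤ T ∧ ∃ u, S.Admissible u ∧ S.Steers u t y x}

/-- The reachable set (positive orbit) of `x`. -/
def posOrbit (S : ControlAffineSystem m M E) (x : M) : Set M :=
  ⋃ T ∈ Ioi (0 : ℝ), S.posOrbitLE T x

/-- Local accessibility in `x`. -/
def LocallyAccessibleAt (S : ControlAffineSystem m M E) (x : M) : Prop :=
  ∀ T > 0, (interior (S.posOrbitLE T x)).Nonempty ∧ (interior (S.negOrbitLE T x)).Nonempty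

/-- The two properties of a set `D` whose maximality defines control sets: from every point of `D`
one can stay in `D` for all `t ≥ 0`, and approximate controllability holds on `D`. -/
def IsApproxControllable (S : ControlAffineSystem m M E) (D : Set M) : Prop :=
  (∀ x ∈ D, ∃ u, S.Admissible u ∧ ∃ ξ, S.IsSolution u ξ ∧ ξ 0 = x ∧ ∀ t ≥ 0, ξ t ∈ D) ∧
    ∀ x ∈ D, D ⊆ closure (S.posOrbit x)

/-- Control sets. -/
def IsControlSet (S : ControlAffineSystem m M E) (D : Set M) : Prop :=
  D.Nonempty ∧ S.IsApproxControllable D ∧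
    ∀ D' : Set M, D ⊆ D' → S.IsApproxControllable D' → D' = D

end ControlAffineSystem

/-- The matrix `P` applied to the vector `x`. -/
def matVec {n : ℕ} (P : Matrix (Fin n) (Fin n) ℝ) (x : EuclideanSpace ℝ (Fin n)) :
    EuclideanSpace ℝ (Fin n) :=
  WithLp.toLp 2 (P.mulVec x.ofLp)

/-- The homogeneous bilinear system `ẋ = A x + ∑ i, uᵢ(t) Bᵢ x` on `ℝⁿ`. -/
def bilinearSystem {n m : ℕ} (A : Matrix (Fin n) (Fin n) ℝ) (B : Fin m → Matrix (Fin n) (Fin n) ℝ)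
    (Ω : Set (EuclideanSpace ℝ (Fin m))) :
    ControlAffineSystem m (EuclideanSpace ℝ (Fin n)) (EuclideanSpace ℝ (Fin n)) where
  ι := id
  f₀ := matVec A
  f i := matVec (B i)
  Ω := Ω

/-- The vector field `s ↦ P s - (sᵀ P s) s` on the unit sphere: the linear vector field of `P` without
its radial component. -/
def sphereField {n : ℕ} (P : Matrix (Fin n) (Fin n) ℝ)
    (s : Metric.sphere (0 : EuclideanSpace ℝ (Fin n)) 1) : EuclideanSpace ℝ (Fin n) :=
  matVec P s - inner ℝ (s : EuclideanSpace ℝ (Fin n)) (matVec P s) • (s : EuclideanSpace ℝ (Fin n))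

/-- The system induced on the Euclidean unit sphere by the homogeneous bilinear system. -/
def sphereSystem {n m : ℕ} (A : Matrix (Fin n) (Fin n) ℝ) (B : Fin m → Matrix (Fin n) (Fin n) ℝ)
    (Ω : Set (EuclideanSpace ℝ (Fin m))) :
    ControlAffineSystem m (Metric.sphere (0 : EuclideanSpace ℝ (Fin n)) 1)
      (EuclideanSpace ℝ (Fin n)) where
  ι := Subtype.val
  f₀ := sphereField A
  f i := sphereField (B i)
  Ω := Ω

/-- The cone `{α s | α > 0, s ∈ D}` generated by a subset `D` of the unit sphere. -/
def coneOver {n : ℕ} (D : Set (Metric.sphere (0 : EuclideanSpace ℝ (Fin n)) 1)) :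
    Set (EuclideanSpace ℝ (Fin n)) :=
  {x | ∃ α : ℝ, 0 < α ∧ ∃ s ∈ D, x = α • (s : EuclideanSpace ℝ (Fin n))}

end

/-!
Write `M(v) = A + ∑ i, vᵢ Bᵢ`. The system on the sphere is the radial projection of the bilinear
system: if `s` is a trajectory on the sphere for the control `u`, then `r s` with
`r(t) = exp ∫₀ᵗ ⟪s, M(u) s⟫` is a trajectory in `ℝⁿ` for the same control (`exists_linear_lift`),
and conversely `x / ‖x‖` is a trajectory on the sphere whenever `x` is a nonzero trajectory in `ℝⁿ`
(`normalized_integral_eq`); a trajectory that vanishes once vanishes identically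
(`eq_zero_of_linear_integral_eq`). Since the controls are only measurable, these computations are
made almost everywhere: an integral equation with locally bounded integrand is equivalent to a
differential equation almost everywhere for a locally Lipschitz curve
(`integral_eq_iff_locallyLipschitz`).

Lifting trajectories shows that one can stay in the cone. For approximate controllability on the
cone, the angular part is controlled as on the sphere, where local accessibility improves
approximate to exact controllability into the interior of `D`
(`exists_smul_mem_posOrbit_of_mem_interior`), so every ray over `int D` is hit exactly, at an
uncontrolled radius. The radius is corrected by running `k` times through a loop with multiplier
`a > 1` and `l` times through a loop with multiplier `b < 1`. Because a whole interval of
multipliers `a` is available, `log a / log b` may be taken irrational, and then the numbers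
`aᵏ bˡ` are dense in the positive reals (`exists_mul_pow_mul_pow_mem`,
`coneOver_subset_closure_posOrbit`).

For maximality, an approximately controllable set that contains the cone does not contain the
origin, an equilibrium for every control. Hence it projects to an approximately controllable set on
the sphere, which contains `D` and so equals `D` (`subset_coneOver_of_isApproxControllable`).
-/

/-! ### Integral equations and almost everywhere derivatives -/

section Calculus

variable {E : Type*} [NormedAddCommGroup E]

theorem locallyIntegrable_of_ae_norm_le {f : ℝ → E} {g : ℝ → ℝ}
    (hf : AEStronglyMeasurable f volume) (hg : Continuous g) (hfg : ∀ᵐ t, ‖f t‖ ≤ g t) :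
    LocallyIntegrable f volume :=
  hg.locallyIntegrable.mono hf (by
    filter_upwards [hfg] with t ht
    exact ht.trans (le_abs_self _))

theorem intervalIntegrable_of_ae_norm_le {f : ℝ → E} {g : ℝ → ℝ}
    (hf : AEStronglyMeasurable f volume) (hg : Continuous g) (hfg : ∀ᵐ t, ‖f t‖ ≤ g t) (a b : ℝ) :
    IntervalIntegrable f volume a b :=
  intervalIntegrable_iff.mpr <|
    ((locallyIntegrable_of_ae_norm_le hf hg hfg).integrableOn_isCompact isCompact_uIcc).mono_set
      uIoc_subset_uIcc

variable [NormedSpace ℝ E]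

/-- Locally Lipschitz curves are absolutely continuous, so they are determined by their initial
value and their derivative almost everywhere. -/
theorem eq_of_locallyLipschitz_of_ae_hasDerivAt {x y f : ℝ → E} (hx : LocallyLipschitz x)
    (hy : LocallyLipschitz y) (h0 : x 0 = y 0) (hxd : ∀ᵐ t, HasDerivAt x (f t) t)
    (hyd : ∀ᵐ t, HasDerivAt y (f t) t) (t : ℝ) : x t = y t := by
  have hF : LocallyLipschitz fun t => x t - y t :=
    hx.sub hy
  obtain ⟨K, hK⟩ := LocallyLipschitzOn.exists_lipschitzOnWith_of_compact
    (isCompact_uIcc (a := (0 : ℝ)) (b := t)) (hF.locallyLipschitzOn (s := uIcc 0 t))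
  obtain ⟨C, hC⟩ := hK.absolutelyContinuousOnInterval.const_of_ae_hasDerivAt_zero (by
    filter_upwards [hxd, hyd] with s h1 h2 _
    simpa using! h1.sub h2)
  have h1 := hC 0 left_mem_uIcc
  have h2 := hC t right_mem_uIcc
  simp only [h0, sub_self] at h1
  rw [← h1] at h2
  exact sub_eq_zero.1 h2

theorem locallyLipschitz_integral {f : ℝ → E} {g : ℝ → ℝ}
    (hf : AEStronglyMeasurable f volume) (hg : Continuous g) (hfg : ∀ᵐ t, ‖f t‖ ≤ g t) (a : ℝ) :
    LocallyLipschitz fun t => ∫ τ in a..t, f τ := by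
  intro t₀
  obtain ⟨C, hC⟩ := (isCompact_Icc (a := t₀ - 1) (b := t₀ + 1)).exists_bound_of_continuousOn
    hg.continuousOn
  refine ⟨C.toNNReal, Icc (t₀ - 1) (t₀ + 1), Icc_mem_nhds (by linarith) (by linarith), ?_⟩
  refine LipschitzOnWith.of_dist_le_mul fun s hs t ht => ?_
  have hi := intervalIntegrable_of_ae_norm_le hf hg hfg
  have hC0 : 0 ≤ C := (norm_nonneg _).trans (hC s hs)
  rw [dist_eq_norm, intervalIntegral.integral_interval_sub_left (hi _ _) (hi _ _),
    Real.coe_toNNReal _ hC0, Real.dist_eq]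
  refine intervalIntegral.norm_integral_le_of_norm_le_const_ae ?_
  filter_upwards [hfg] with τ hτ hmem
  refine hτ.trans ((le_abs_self _).trans (hC τ ?_))
  exact uIcc_subset_Icc ht hs (uIoc_subset_uIcc hmem)

/-- Integral equations with a locally bounded integrand are the same as differential equations
that hold almost everywhere, for locally Lipschitz curves. -/
theorem integral_eq_iff_locallyLipschitz [CompleteSpace E] {x f : ℝ → E} {g : ℝ → ℝ}
    (hf : AEStronglyMeasurable f volume) (hg : Continuous g) (hfg : ∀ᵐ t, ‖f t‖ ≤ g t) :
    (∀ t, x t = x 0 + ∫ τ in (0 : ℝ)..t, f τ) ↔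
      LocallyLipschitz x ∧ ∀ᵐ t, HasDerivAt x (f t) t := by
  have hL : LocallyLipschitz fun t => x 0 + ∫ τ in (0 : ℝ)..t, f τ :=
    (LocallyLipschitz.const (x 0)).add (locallyLipschitz_integral hf hg hfg 0)
  have hd : ∀ᵐ t, HasDerivAt (fun t => x 0 + ∫ τ in (0 : ℝ)..t, f τ) (f t) t := by
    filter_upwards [LocallyIntegrable.ae_hasDerivAt_integral
      (locallyIntegrable_of_ae_norm_le hf hg hfg)] with t ht
    exact (ht 0).const_add _
  constructor
  · intro h
    have hx : x = fun t => x 0 + ∫ τ in (0 : ℝ)..t, f τ := funext h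
    rw [← hx] at hL hd
    exact ⟨hL, hd⟩
  · rintro ⟨h1, h2⟩ t
    exact eq_of_locallyLipschitz_of_ae_hasDerivAt h1 hL (by simp) h2 hd t

end Calculus

/-! ### Linear equations and their radial projection -/

theorem norm_inv_smul_mem_sphere {E : Type*} [NormedAddCommGroup E] [NormedSpace ℝ E] {x : E}
    (hx : x ≠ 0) : ‖x‖⁻¹ • x ∈ Metric.sphere (0 : E) 1 := by
  rw [mem_sphere_zero_iff_norm, norm_smul, norm_inv, norm_norm,
    inv_mul_cancel₀ (norm_ne_zero_iff.2 hx)]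

theorem norm_inv_smul_smul_sphere {E : Type*} [NormedAddCommGroup E] [NormedSpace ℝ E] {c : ℝ}
    (hc : 0 < c) (s : Metric.sphere (0 : E) 1) : ‖c • (s : E)‖⁻¹ • c • (s : E) = s := by
  rw [norm_smul, norm_eq_of_mem_sphere, mul_one, Real.norm_of_nonneg hc.le, smul_smul,
    inv_mul_cancel₀ hc.ne', one_smul]

section Radial

variable {E : Type*} [NormedAddCommGroup E]

section
variable [NormedSpace ℝ E]

theorem norm_apply_le_of_opNorm_le {M : ℝ → E →L[ℝ] E} {C : ℝ} (hC : ∀ᵐ t, ‖M t‖ ≤ C)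
    (x : ℝ → E) : ∀ᵐ t, ‖M t (x t)‖ ≤ C * ‖x t‖ := by
  filter_upwards [hC] with t ht
  exact (M t).le_of_opNorm_le ht _

theorem aestronglyMeasurable_clm_apply {M : ℝ → E →L[ℝ] E} (hM : AEStronglyMeasurable M volume)
    {x : ℝ → E} (hx : AEStronglyMeasurable x volume) :
    AEStronglyMeasurable (fun t => M t (x t)) volume :=
  (isBoundedBilinearMap_apply.continuous.comp_aestronglyMeasurable (hM.prodMk hx))

/-- A solution of a linear equation with bounded coefficients that vanishes at some time vanishes
identically: on an interval of length less than `1 / (2 C)` around a zero, the maximum of the norm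
is at most half of itself, so the set of zeros is open. -/
theorem eq_zero_of_linear_integral_eq {M : ℝ → E →L[ℝ] E} (hM : AEStronglyMeasurable M volume)
    {C : ℝ} (hC : ∀ᵐ t, ‖M t‖ ≤ C) {x : ℝ → E} (hx : Continuous x)
    (hsol : ∀ t, x t = x 0 + ∫ τ in (0 : ℝ)..t, M τ (x τ)) {t₀ : ℝ} (h0 : x t₀ = 0) (t : ℝ) :
    x t = 0 := by
  have hC0 : 0 ≤ C := by
    obtain ⟨t, ht⟩ := hC.exists
    exact (norm_nonneg _).trans ht
  have hi := intervalIntegrable_of_ae_norm_le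
    (aestronglyMeasurable_clm_apply hM hx.aestronglyMeasurable)
    (g := fun t => C * ‖x t‖) (by fun_prop) (norm_apply_le_of_opNorm_le hC x)
  have hcl : IsClosed {t | x t = 0} := isClosed_eq hx continuous_const
  have hop : IsOpen {t | x t = 0} := by
    rw [isOpen_iff_mem_nhds]
    intro t₁ (ht₁ : x t₁ = 0)
    set δ : ℝ := 1 / (2 * (C + 1)) with hδ
    have hδ0 : 0 < δ := by positivity
    have hCδ : C * δ ≤ 1 / 2 := by
      rw [hδ, mul_one_div, div_le_div_iff₀ (by positivity) (by norm_num)]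
      linarith
    obtain ⟨s, hs, hmax⟩ := (isCompact_Icc (a := t₁ - δ) (b := t₁ + δ)).exists_isMaxOn
      ⟨t₁, by constructor <;> linarith⟩ (f := fun t => ‖x t‖) hx.norm.continuousOn
    have hxs : x s = ∫ τ in t₁..s, M τ (x τ) := by
      have h1 := hsol s
      have h2 := hsol t₁
      rw [ht₁] at h2
      rw [← intervalIntegral.integral_interval_sub_left (hi 0 s) (hi 0 t₁), h1, eq_sub_iff_add_eq,
        add_right_comm, ← h2, zero_add]
    have hle : ‖x s‖ ≤ C * ‖x s‖ * |s - t₁| := by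
      conv_lhs => rw [hxs]
      refine intervalIntegral.norm_integral_le_of_norm_le_const_ae ?_
      filter_upwards [hC] with τ hτ hmem
      refine (M τ).le_of_opNorm_le_of_le hτ (hmax (a := τ) ?_)
      exact uIcc_subset_Icc (by constructor <;> linarith) hs (uIoc_subset_uIcc hmem)
    have hsδ : |s - t₁| ≤ δ := abs_le.2 ⟨by linarith [hs.1], by linarith [hs.2]⟩
    have hs0 : ‖x s‖ = 0 := by
      have h1 : C * ‖x s‖ * |s - t₁| ≤ C * ‖x s‖ * δ := by gcongr
      have h2 : C * ‖x s‖ * δ ≤ 1 / 2 * ‖x s‖ := by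
        calc C * ‖x s‖ * δ = C * δ * ‖x s‖ := by ring
          _ ≤ _ := by gcongr
      linarith [norm_nonneg (x s)]
    filter_upwards [Icc_mem_nhds (show t₁ - δ < t₁ by linarith) (show t₁ < t₁ + δ by linarith)]
      with t ht
    have := hmax ht
    exact norm_le_zero_iff.1 (this.trans_eq hs0)
  exact eq_univ_iff_forall.1 (IsClopen.eq_univ ⟨hcl, hop⟩ ⟨t₀, h0⟩) t

end

variable [InnerProductSpace ℝ E]

theorem ae_norm_radial_le {M : ℝ → E →L[ℝ] E} {C : ℝ} (hC : ∀ᵐ t, ‖M t‖ ≤ C) {s : ℝ → E}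
    (hs1 : ∀ t, ‖s t‖ = 1) : ∀ᵐ t, ‖inner ℝ (s t) (M t (s t))‖ ≤ C := by
  filter_upwards [norm_apply_le_of_opNorm_le hC s] with t ht
  refine (norm_inner_le_norm _ _).trans ?_
  rw [hs1, mul_one] at ht
  rwa [hs1, one_mul]

theorem ae_norm_tangential_le {M : ℝ → E →L[ℝ] E} {C : ℝ} (hC : ∀ᵐ t, ‖M t‖ ≤ C) {s : ℝ → E}
    (hs1 : ∀ t, ‖s t‖ = 1) :
    ∀ᵐ t, ‖M t (s t) - inner ℝ (s t) (M t (s t)) • s t‖ ≤ C + C := by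
  filter_upwards [norm_apply_le_of_opNorm_le hC s, ae_norm_radial_le hC hs1] with t h1 h2
  refine (norm_sub_le _ _).trans (add_le_add ?_ ?_)
  · simpa [hs1] using h1
  · rwa [norm_smul, hs1, mul_one]

theorem aestronglyMeasurable_radial {M : ℝ → E →L[ℝ] E} (hM : AEStronglyMeasurable M volume)
    {s : ℝ → E} (hs : Continuous s) :
    AEStronglyMeasurable (fun t => inner ℝ (s t) (M t (s t))) volume :=
  hs.aestronglyMeasurable.inner (aestronglyMeasurable_clm_apply hM hs.aestronglyMeasurable)

theorem aestronglyMeasurable_tangential {M : ℝ → E →L[ℝ] E} (hM : AEStronglyMeasurable M volume)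
    {s : ℝ → E} (hs : Continuous s) :
    AEStronglyMeasurable (fun t => M t (s t) - inner ℝ (s t) (M t (s t)) • s t) volume :=
  (aestronglyMeasurable_clm_apply hM hs.aestronglyMeasurable).sub
    ((aestronglyMeasurable_radial hM hs).smul hs.aestronglyMeasurable)

variable [CompleteSpace E]

/-- Solutions on the unit sphere lift to solutions of the linear equation: the radial component is
`exp ∫ ⟪s, M s⟫`. -/
theorem exists_linear_lift {M : ℝ → E →L[ℝ] E} (hM : AEStronglyMeasurable M volume)
    {C : ℝ} (hC : ∀ᵐ t, ‖M t‖ ≤ C) {s : ℝ → E} (hs : Continuous s) (hs1 : ∀ t, ‖s t‖ = 1)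
    (hsol : ∀ t, s t = s 0 + ∫ τ in (0 : ℝ)..t, (M τ (s τ) - inner ℝ (s τ) (M τ (s τ)) • s τ)) :
    ∃ r : ℝ → ℝ, (∀ t, 0 < r t) ∧ r 0 = 1 ∧ Continuous (fun t => r t • s t) ∧
      ∀ t, r t • s t = r 0 • s 0 + ∫ τ in (0 : ℝ)..t, M τ (r τ • s τ) := by
  have hgm := aestronglyMeasurable_radial hM hs
  have hgC := ae_norm_radial_le hC hs1
  set g : ℝ → ℝ := fun t => inner ℝ (s t) (M t (s t)) with hg
  obtain ⟨hsL, hsd⟩ := (integral_eq_iff_locallyLipschitz (aestronglyMeasurable_tangential hM hs)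
    continuous_const (ae_norm_tangential_le hC hs1)).1 hsol
  set r : ℝ → ℝ := fun t => Real.exp (∫ τ in (0 : ℝ)..t, g τ) with hr
  have hrL : LocallyLipschitz r :=
    (Real.contDiff_exp (n := 1)).locallyLipschitz.comp
      (locallyLipschitz_integral hgm continuous_const hgC 0)
  have hrd : ∀ᵐ t, HasDerivAt r (r t * g t) t := by
    filter_upwards [LocallyIntegrable.ae_hasDerivAt_integral
      (locallyIntegrable_of_ae_norm_le hgm continuous_const hgC)] with t ht
    exact (ht 0).exp
  have hrs : LocallyLipschitz fun t => r t • s t :=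
    (contDiff_smul (𝕜 := ℝ) (F := E) (n := 1)).locallyLipschitz.comp (hrL.prodMk hsL)
  refine ⟨r, fun t => Real.exp_pos _, by simp [hr], hrs.continuous, ?_⟩
  refine (integral_eq_iff_locallyLipschitz (x := fun t => r t • s t)
    (aestronglyMeasurable_clm_apply hM hrs.continuous.aestronglyMeasurable)
    (g := fun t => C * ‖r t • s t‖) (continuous_const.mul hrs.continuous.norm)
    (norm_apply_le_of_opNorm_le hC _)).2 ⟨hrs, ?_⟩
  filter_upwards [hrd, hsd] with t h1 h2
  convert! h1.smul h2 using 1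
  rw [map_smul, smul_sub, mul_smul]
  abel

/-- Nonzero solutions of the linear equation project to solutions on the unit sphere. -/
theorem normalized_integral_eq {M : ℝ → E →L[ℝ] E} (hM : AEStronglyMeasurable M volume)
    {C : ℝ} (hC : ∀ᵐ t, ‖M t‖ ≤ C) {x : ℝ → E} (hx : Continuous x) (hx0 : ∀ t, x t ≠ 0)
    (hsol : ∀ t, x t = x 0 + ∫ τ in (0 : ℝ)..t, M τ (x τ)) {s : ℝ → E}
    (hs : ∀ t, s t = ‖x t‖⁻¹ • x t) :
    Continuous s ∧ ∀ t, s t = s 0 + ∫ τ in (0 : ℝ)..t,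
      (M τ (s τ) - inner ℝ (s τ) (M τ (s τ)) • s τ) := by
  obtain ⟨hxL, hxd⟩ := (integral_eq_iff_locallyLipschitz
    (aestronglyMeasurable_clm_apply hM hx.aestronglyMeasurable)
    (g := fun t => C * ‖x t‖) (continuous_const.mul hx.norm)
    (norm_apply_le_of_opNorm_le hC _)).1 hsol
  obtain rfl : s = fun t => ‖x t‖⁻¹ • x t := funext hs
  have hs1 : ∀ t, ‖‖x t‖⁻¹ • x t‖ = 1 := fun t =>
    mem_sphere_zero_iff_norm.1 (norm_inv_smul_mem_sphere (hx0 t))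
  have hsL : LocallyLipschitz fun t => ‖x t‖⁻¹ • x t := by
    intro t
    have hcd : ContDiffAt ℝ 1 (fun z : E => ‖z‖⁻¹ • z) (x t) :=
      ((contDiffAt_norm ℝ (hx0 t)).inv (norm_ne_zero_iff.2 (hx0 t))).smul contDiffAt_id
    obtain ⟨K, U, hU, hK⟩ := hcd.exists_lipschitzOnWith
    obtain ⟨K', V, hV, hK'⟩ := hxL t
    exact ⟨K * K', V ∩ x ⁻¹' U, Filter.inter_mem hV (hx.continuousAt hU),
      hK.comp (hK'.mono inter_subset_left) ((mapsTo_preimage x U).mono_left inter_subset_right)⟩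
  refine ⟨hsL.continuous, (integral_eq_iff_locallyLipschitz (x := fun t => ‖x t‖⁻¹ • x t)
    (aestronglyMeasurable_tangential hM hsL.continuous)
    continuous_const (ae_norm_tangential_le hC hs1)).2 ⟨hsL, ?_⟩⟩
  filter_upwards [hxd] with t ht
  have hn : ‖x t‖ ≠ 0 := norm_ne_zero_iff.2 (hx0 t)
  have hnorm : HasDerivAt (fun t => ‖x t‖) (inner ℝ (x t) (M t (x t)) / ‖x t‖) t := by
    have h := (ht.norm_sq).sqrt (pow_ne_zero 2 hn)
    simp only [Real.sqrt_sq (norm_nonneg _)] at h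
    convert! h using 1
    field_simp
  convert! (hnorm.inv hn).smul ht using 1
  simp only [map_smul, inner_smul_left, inner_smul_right, smul_smul, conj_trivial]
  rw [sub_eq_add_neg, ← neg_smul]
  congr 2
  field_simp

end Radial

/-! ### The bilinear system and the system on the sphere -/

section Systems

variable {n m : ℕ} (A : Matrix (Fin n) (Fin n) ℝ) (B : Fin m → Matrix (Fin n) (Fin n) ℝ)

/-- The linear map `A + ∑ i, vᵢ Bᵢ` for the control value `v`. -/
noncomputable def controlledMap (v : EuclideanSpace ℝ (Fin m)) :
    EuclideanSpace ℝ (Fin n) →L[ℝ] EuclideanSpace ℝ (Fin n) :=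
  Matrix.toEuclideanCLM (𝕜 := ℝ) A + ∑ i, v i • Matrix.toEuclideanCLM (𝕜 := ℝ) (B i)

theorem continuous_controlledMap : Continuous (controlledMap A B) := by
  unfold controlledMap
  fun_prop

theorem toEuclideanCLM_apply_eq_matVec (P : Matrix (Fin n) (Fin n) ℝ)
    (x : EuclideanSpace ℝ (Fin n)) : Matrix.toEuclideanCLM (𝕜 := ℝ) P x = matVec P x := rfl

variable (Ω : Set (EuclideanSpace ℝ (Fin m)))

theorem bilinearSystem_rhs (v : EuclideanSpace ℝ (Fin m)) (x : EuclideanSpace ℝ (Fin n)) :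
    (bilinearSystem A B Ω).rhs v x = controlledMap A B v x := by
  simp [ControlAffineSystem.rhs, bilinearSystem, controlledMap, toEuclideanCLM_apply_eq_matVec]

theorem sphereSystem_rhs (v : EuclideanSpace ℝ (Fin m))
    (s : Metric.sphere (0 : EuclideanSpace ℝ (Fin n)) 1) :
    (sphereSystem A B Ω).rhs v s = controlledMap A B v s -
      inner ℝ (s : EuclideanSpace ℝ (Fin n)) (controlledMap A B v s) •
        (s : EuclideanSpace ℝ (Fin n)) := by
  simp only [ControlAffineSystem.rhs, sphereSystem, sphereField, controlledMap,
    toEuclideanCLM_apply_eq_matVec, sum_apply, add_apply, smul_apply, inner_add_right, inner_sum,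
    inner_smul_right, add_smul,
    Finset.sum_smul, smul_sub, Finset.sum_sub_distrib, smul_smul]
  abel

variable {A B Ω}

theorem aestronglyMeasurable_controlledMap {u : ℝ → EuclideanSpace ℝ (Fin m)}
    (hu : (bilinearSystem A B Ω).Admissible u) :
    AEStronglyMeasurable (fun t => controlledMap A B (u t)) volume :=
  (continuous_controlledMap A B).comp_aestronglyMeasurable hu.1.1

/-- Compactness of the control range bounds the coefficients uniformly in the control. -/
theorem exists_controlledMap_bound (hΩ : IsCompact Ω) :
    ∃ C : ℝ, ∀ u, (bilinearSystem A B Ω).Admissible u → ∀ᵐ t, ‖controlledMap A B (u t)‖ ≤ C := by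
  obtain ⟨C, hC⟩ := hΩ.exists_bound_of_continuousOn (continuous_controlledMap A B).continuousOn
  exact ⟨C, fun u hu => hu.2.mono fun t ht => hC _ ht⟩

theorem isSolution_bilinearSystem_iff {u : ℝ → EuclideanSpace ℝ (Fin m)}
    {x : ℝ → EuclideanSpace ℝ (Fin n)} :
    (bilinearSystem A B Ω).IsSolution u x ↔ Continuous x ∧
      ∀ t, x t = x 0 + ∫ τ in (0 : ℝ)..t, controlledMap A B (u τ) (x τ) := by
  simp only [ControlAffineSystem.IsSolution, bilinearSystem_rhs]
  rfl

theorem isSolution_sphereSystem_iff {u : ℝ → EuclideanSpace ℝ (Fin m)}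
    {s : ℝ → Metric.sphere (0 : EuclideanSpace ℝ (Fin n)) 1} :
    (sphereSystem A B Ω).IsSolution u s ↔ Continuous s ∧
      ∀ t, (s t : EuclideanSpace ℝ (Fin n)) = s 0 + ∫ τ in (0 : ℝ)..t,
        (controlledMap A B (u τ) (s τ) -
          inner ℝ (s τ : EuclideanSpace ℝ (Fin n)) (controlledMap A B (u τ) (s τ)) •
            (s τ : EuclideanSpace ℝ (Fin n))) := by
  simp only [ControlAffineSystem.IsSolution, sphereSystem_rhs]
  rfl

theorem ControlAffineSystem.IsSolution.smul {u : ℝ → EuclideanSpace ℝ (Fin m)}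
    {x : ℝ → EuclideanSpace ℝ (Fin n)} (hx : (bilinearSystem A B Ω).IsSolution u x) (c : ℝ) :
    (bilinearSystem A B Ω).IsSolution u fun t => c • x t := by
  rw [isSolution_bilinearSystem_iff] at hx ⊢
  refine ⟨hx.1.const_smul c, fun t => ?_⟩
  simp only [map_smul, intervalIntegral.integral_smul]
  rw [← smul_add, ← hx.2 t]

/-- A trajectory on the sphere is the radial projection of a trajectory in `ℝⁿ` with the same
control. -/
theorem exists_bilinear_solution_of_sphere (hΩ : IsCompact Ω)
    {u : ℝ → EuclideanSpace ℝ (Fin m)} (hu : (bilinearSystem A B Ω).Admissible u)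
    {s : ℝ → Metric.sphere (0 : EuclideanSpace ℝ (Fin n)) 1}
    (hs : (sphereSystem A B Ω).IsSolution u s) :
    ∃ r : ℝ → ℝ, (∀ t, 0 < r t) ∧ r 0 = 1 ∧
      (bilinearSystem A B Ω).IsSolution u fun t => r t • (s t : EuclideanSpace ℝ (Fin n)) := by
  obtain ⟨C, hC⟩ := exists_controlledMap_bound (A := A) (B := B) hΩ
  rw [isSolution_sphereSystem_iff] at hs
  obtain ⟨r, h1, h2, h3, h4⟩ := exists_linear_lift (aestronglyMeasurable_controlledMap hu)
    (hC u hu) (continuous_subtype_val.comp hs.1) (fun t => by simp) hs.2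
  exact ⟨r, h1, h2, isSolution_bilinearSystem_iff.2 ⟨h3, h4⟩⟩

theorem bilinear_solution_ne_zero (hΩ : IsCompact Ω)
    {u : ℝ → EuclideanSpace ℝ (Fin m)} (hu : (bilinearSystem A B Ω).Admissible u)
    {x : ℝ → EuclideanSpace ℝ (Fin n)} (hx : (bilinearSystem A B Ω).IsSolution u x)
    {t₀ : ℝ} (h0 : x t₀ ≠ 0) (t : ℝ) : x t ≠ 0 := by
  obtain ⟨C, hC⟩ := exists_controlledMap_bound (A := A) (B := B) hΩ
  rw [isSolution_bilinearSystem_iff] at hx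
  exact fun ht => h0 (eq_zero_of_linear_integral_eq (aestronglyMeasurable_controlledMap hu)
    (hC u hu) hx.1 hx.2 ht t₀)

/-- The radial projection of a trajectory in `ℝⁿ \ {0}` is a trajectory on the sphere. -/
theorem exists_sphere_solution_of_bilinear (hΩ : IsCompact Ω)
    {u : ℝ → EuclideanSpace ℝ (Fin m)} (hu : (bilinearSystem A B Ω).Admissible u)
    {x : ℝ → EuclideanSpace ℝ (Fin n)} (hx : (bilinearSystem A B Ω).IsSolution u x)
    (h0 : x 0 ≠ 0) :
    ∃ s : ℝ → Metric.sphere (0 : EuclideanSpace ℝ (Fin n)) 1,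
      (sphereSystem A B Ω).IsSolution u s ∧
        ∀ t, (s t : EuclideanSpace ℝ (Fin n)) = ‖x t‖⁻¹ • x t := by
  have hne := bilinear_solution_ne_zero hΩ hu hx h0
  obtain ⟨C, hC⟩ := exists_controlledMap_bound (A := A) (B := B) hΩ
  rw [isSolution_bilinearSystem_iff] at hx
  let s : ℝ → Metric.sphere (0 : EuclideanSpace ℝ (Fin n)) 1 := fun t =>
    ⟨‖x t‖⁻¹ • x t, norm_inv_smul_mem_sphere (hne t)⟩
  obtain ⟨h1, h2⟩ := normalized_integral_eq (aestronglyMeasurable_controlledMap hu)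
    (hC u hu) hx.1 hne hx.2 (s := fun t => (s t : EuclideanSpace ℝ (Fin n))) fun t => rfl
  exact ⟨s, isSolution_sphereSystem_iff.2 ⟨h1.subtype_mk _, h2⟩, fun t => rfl⟩

/-- The speed on the sphere is bounded uniformly in the control. -/
theorem exists_sphere_speed_bound (hΩ : IsCompact Ω) :
    ∃ L : ℝ, ∀ u, (sphereSystem A B Ω).Admissible u → ∀ s, (sphereSystem A B Ω).IsSolution u s →
      ∀ t ≥ 0, dist (s t) (s 0) ≤ L * t := by
  obtain ⟨C, hC⟩ := exists_controlledMap_bound (A := A) (B := B) hΩ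
  refine ⟨C + C, fun u hu s hs t ht => ?_⟩
  rw [isSolution_sphereSystem_iff] at hs
  rw [Subtype.dist_eq, dist_eq_norm, hs.2 t, add_sub_cancel_left]
  have h := intervalIntegral.norm_integral_le_of_norm_le_const_ae (a := 0) (b := t)
    ((ae_norm_tangential_le (hC u hu) (s := fun t => (s t : EuclideanSpace ℝ (Fin n)))
      fun t => by simp).mono fun τ hτ _ => hτ)
  rwa [sub_zero, abs_of_nonneg ht] at h

/-! ### Reachability -/

theorem ControlAffineSystem.mem_posOrbit_iff {M F : Type*} [TopologicalSpace M]
    [NormedAddCommGroup F] [NormedSpace ℝ F] {S : ControlAffineSystem m M F} {x y : M} :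
    y ∈ S.posOrbit x ↔ ∃ t ≥ 0, ∃ u, S.Admissible u ∧ S.Steers u t x y := by
  simp only [ControlAffineSystem.posOrbit, ControlAffineSystem.posOrbitLE, mem_iUnion]
  constructor
  · rintro ⟨T, -, t, ht, -, h⟩
    exact ⟨t, ht, h⟩
  · rintro ⟨t, ht, h⟩
    exact ⟨t + 1, by simp only [mem_Ioi]; linarith, t, ht, by linarith, h⟩

theorem mem_posOrbit_smul {x y : EuclideanSpace ℝ (Fin n)}
    (h : y ∈ (bilinearSystem A B Ω).posOrbit x) (c : ℝ) :
    c • y ∈ (bilinearSystem A B Ω).posOrbit (c • x) := by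
  rw [ControlAffineSystem.mem_posOrbit_iff] at h ⊢
  obtain ⟨t, ht, u, hu, ξ, hξ, rfl, rfl⟩ := h
  exact ⟨t, ht, u, hu, _, hξ.smul c, rfl, rfl⟩

theorem admissible_concat {u v : ℝ → EuclideanSpace ℝ (Fin m)}
    (hu : (bilinearSystem A B Ω).Admissible u) (hv : (bilinearSystem A B Ω).Admissible v) (a : ℝ) :
    (bilinearSystem A B Ω).Admissible ((Iic a).piecewise u fun t => v (t - a)) := by
  have hmp := measurePreserving_sub_right (volume : Measure ℝ) a
  refine ⟨?_, ?_⟩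
  · exact MemLp.piecewise measurableSet_Iic (hu.1.restrict _)
      ((hv.1.comp_measurePreserving hmp).restrict _)
  · filter_upwards [hu.2, hmp.quasiMeasurePreserving.ae hv.2] with t h1 h2
    by_cases ht : t ∈ Iic a
    · rwa [piecewise_eq_of_mem _ _ _ ht]
    · rwa [piecewise_eq_of_notMem _ _ _ ht]

/-- Following `x` up to time `a` and then `y` is a trajectory for the concatenated controls. -/
theorem isSolution_concat (hΩ : IsCompact Ω) {u v : ℝ → EuclideanSpace ℝ (Fin m)}
    (hu : (bilinearSystem A B Ω).Admissible u) (hv : (bilinearSystem A B Ω).Admissible v)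
    {x y : ℝ → EuclideanSpace ℝ (Fin n)} (hx : (bilinearSystem A B Ω).IsSolution u x)
    (hy : (bilinearSystem A B Ω).IsSolution v y) {a : ℝ} (ha : 0 ≤ a) (hxy : x a = y 0) :
    (bilinearSystem A B Ω).IsSolution ((Iic a).piecewise u fun t => v (t - a))
      ((Iic a).piecewise x fun t => y (t - a)) := by
  obtain ⟨C, hC⟩ := exists_controlledMap_bound (A := A) (B := B) hΩ
  have huv := admissible_concat hu hv a
  rw [isSolution_bilinearSystem_iff] at hx hy ⊢
  set w := (Iic a).piecewise u fun t => v (t - a) with hw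
  set z := (Iic a).piecewise x fun t => y (t - a) with hz
  have hzc : Continuous z := by
    refine hx.1.piecewise (fun t ht => ?_) (hy.1.comp (continuous_id.sub continuous_const))
    rw [frontier_Iic, mem_singleton_iff] at ht
    simp [ht, hxy]
  have hi := intervalIntegrable_of_ae_norm_le
    (aestronglyMeasurable_clm_apply (aestronglyMeasurable_controlledMap huv)
      hzc.aestronglyMeasurable) (g := fun t => C * ‖z t‖) (by fun_prop)
    (norm_apply_le_of_opNorm_le (hC _ huv) z)
  have hz0 : z 0 = x 0 := piecewise_eq_of_mem _ _ _ ha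
  have hleft : ∀ t ≤ a, z t = z 0 + ∫ τ in (0 : ℝ)..t, controlledMap A B (w τ) (z τ) := by
    intro t ht
    rw [hz0, show z t = x t from piecewise_eq_of_mem _ _ _ ht, hx.2 t]
    congr 1
    refine intervalIntegral.integral_congr fun τ hτ => ?_
    have hτa : τ ∈ Iic a := (mem_uIcc.1 hτ).elim (fun h => h.2.trans ht) fun h => h.2.trans ha
    simp only [hw, hz, piecewise_eq_of_mem _ _ _ hτa]
  refine ⟨hzc, fun t => ?_⟩
  rcases le_or_gt t a with ht | ht
  · exact hleft t ht
  · have hza : z a = y 0 := by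
      rw [← hxy]
      exact piecewise_eq_of_mem _ _ _ self_mem_Iic
    rw [← intervalIntegral.integral_add_adjacent_intervals (hi 0 a) (hi a t), ← add_assoc,
      ← hleft a le_rfl, hza,
      show z t = y (t - a) from piecewise_eq_of_notMem _ _ _ (notMem_Iic.2 ht), hy.2 (t - a)]
    congr 1
    have h := intervalIntegral.integral_comp_sub_right (a := a) (b := t)
      (fun τ => controlledMap A B (v τ) (y τ)) a
    rw [sub_self] at h
    rw [← h]
    refine intervalIntegral.integral_congr_ae (Filter.Eventually.of_forall fun τ hτ => ?_)
    rw [uIoc_of_le ht.le] at hτ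
    have hτa : τ ∉ Iic a := notMem_Iic.2 hτ.1
    simp only [hw, hz, piecewise_eq_of_notMem _ _ _ hτa]

theorem posOrbit_trans (hΩ : IsCompact Ω) {x y z : EuclideanSpace ℝ (Fin n)}
    (hxy : y ∈ (bilinearSystem A B Ω).posOrbit x) (hyz : z ∈ (bilinearSystem A B Ω).posOrbit y) :
    z ∈ (bilinearSystem A B Ω).posOrbit x := by
  rw [ControlAffineSystem.mem_posOrbit_iff] at hxy hyz ⊢
  obtain ⟨a, ha, u, hu, ξ, hξ, rfl, rfl⟩ := hxy
  obtain ⟨b, hb, v, hv, η, hη, h0, rfl⟩ := hyz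
  refine ⟨a + b, by linarith, _, admissible_concat hu hv a, _,
    isSolution_concat hΩ hu hv hξ hη ha h0.symm, piecewise_eq_of_mem _ _ _ ha, ?_⟩
  rcases hb.eq_or_lt with rfl | hb
  · rw [add_zero, piecewise_eq_of_mem _ _ _ self_mem_Iic, h0]
  · rw [piecewise_eq_of_notMem _ _ _ (notMem_Iic.2 (by linarith)), add_sub_cancel_left]

/-- A loop with multiplier `a` at `x` can be run through any number of times. -/
theorem pow_smul_mem_posOrbit (hΩ : IsCompact Ω) {x : EuclideanSpace ℝ (Fin n)} {a : ℝ}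
    (h : a • x ∈ (bilinearSystem A B Ω).posOrbit x) (k : ℕ) :
    a ^ (k + 1) • x ∈ (bilinearSystem A B Ω).posOrbit x := by
  induction k with
  | zero => simpa using h
  | succ k ih =>
    refine posOrbit_trans hΩ h ?_
    rw [pow_succ', mul_comm, mul_smul, smul_comm]
    exact mem_posOrbit_smul ih a

/-- Reachability on the sphere lifts to reachability between rays. -/
theorem exists_smul_mem_posOrbit (hΩ : IsCompact Ω)
    {s s' : Metric.sphere (0 : EuclideanSpace ℝ (Fin n)) 1}
    (h : s' ∈ (sphereSystem A B Ω).posOrbit s) :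
    ∃ c : ℝ, 0 < c ∧ c • (s' : EuclideanSpace ℝ (Fin n)) ∈
      (bilinearSystem A B Ω).posOrbit (s : EuclideanSpace ℝ (Fin n)) := by
  rw [ControlAffineSystem.mem_posOrbit_iff] at h
  obtain ⟨t, ht, u, hu, ξ, hξ, rfl, rfl⟩ := h
  obtain ⟨r, hr, hr0, hsol⟩ := exists_bilinear_solution_of_sphere hΩ hu hξ
  exact ⟨r t, hr t, ControlAffineSystem.mem_posOrbit_iff.2
    ⟨t, ht, u, hu, _, hsol, by simp [hr0], rfl⟩⟩

/-- Reachability in `ℝⁿ \ {0}` projects to reachability on the sphere. -/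
theorem mem_posOrbit_sphere (hΩ : IsCompact Ω)
    {s : Metric.sphere (0 : EuclideanSpace ℝ (Fin n)) 1} {c : ℝ} (hc : 0 < c)
    {y : EuclideanSpace ℝ (Fin n)}
    (h : y ∈ (bilinearSystem A B Ω).posOrbit (c • (s : EuclideanSpace ℝ (Fin n)))) :
    ∃ s' ∈ (sphereSystem A B Ω).posOrbit s, (s' : EuclideanSpace ℝ (Fin n)) = ‖y‖⁻¹ • y := by
  rw [ControlAffineSystem.mem_posOrbit_iff] at h
  obtain ⟨t, ht, u, hu, ξ, hξ, h0, rfl⟩ := h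
  obtain ⟨η, hη, hηξ⟩ := exists_sphere_solution_of_bilinear hΩ hu hξ (by
    rw [h0]
    exact smul_ne_zero hc.ne' (ne_zero_of_mem_unit_sphere s))
  refine ⟨η t, ControlAffineSystem.mem_posOrbit_iff.2 ⟨t, ht, u, hu, η, hη, ?_, rfl⟩, hηξ t⟩
  ext1
  rw [hηξ, h0, norm_inv_smul_smul_sphere hc]

theorem posOrbit_zero_subset (hΩ : IsCompact Ω) :
    (bilinearSystem A B Ω).posOrbit 0 ⊆ {0} := by
  intro y hy
  rw [ControlAffineSystem.mem_posOrbit_iff] at hy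
  obtain ⟨t, -, u, hu, ξ, hξ, h0, rfl⟩ := hy
  by_contra h
  exact bilinear_solution_ne_zero hΩ hu hξ h 0 h0

end Systems

/-! ### Products of powers with incommensurable logarithms -/

/-- Positive integer combinations of a positive and a negative number with irrational quotient are
dense: the multiples of `a` accumulate at every point of the circle `ℝ / bℤ`, and a large multiple
of `a` is brought back to a bounded range by a positive multiple of `b`. -/
theorem exists_nat_combination_near {a b : ℝ} (ha : 0 < a) (hb : b < 0) (hab : Irrational (a / b))
    (x : ℝ) {ε : ℝ} (hε : 0 < ε) :
    ∃ k l : ℕ, (k + 1) * a + (l + 1) * b ∈ Metric.ball x ε := by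
  have : Fact (0 < -b) := ⟨by linarith⟩
  have hd : DenseRange (fun k : ℤ => k • (a : AddCircle (-b))) := by
    rw [AddCircle.denseRange_zsmul_coe_iff, div_neg]
    exact hab.neg
  have hcl : MapClusterPt (x : AddCircle (-b)) Filter.atTop
      (fun k : ℕ => k • (a : AddCircle (-b))) :=
    ((mapClusterPt_atTop_nsmul_tfae (x : AddCircle (-b)) (a : AddCircle (-b))).out 0 3).2 (hd _)
  have hU : ((↑) : ℝ → AddCircle (-b)) '' Metric.ball x ε ∈ nhds (x : AddCircle (-b)) :=
    QuotientAddGroup.isOpenMap_coe.image_mem_nhds (Metric.ball_mem_nhds x hε)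
  obtain ⟨N, hN⟩ := exists_nat_gt ((x + ε) / a)
  obtain ⟨k, hkN, y, hy, hyk⟩ :=
    Filter.frequently_atTop.1 (mapClusterPt_iff_frequently.1 hcl _ hU) (N + 1)
  have hyk' : ((y - k * a : ℝ) : AddCircle (-b)) = 0 := by
    rw [AddCircle.coe_sub, hyk, ← nsmul_eq_mul, AddCircle.coe_nsmul, sub_self]
  obtain ⟨z, hz⟩ := AddCircle.coe_eq_zero_iff _ |>.1 hyk'
  rw [zsmul_eq_mul] at hz
  -- `k a` exceeds `y` since `k > N`, so the multiple of `b` that is needed is positive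
  have hyx : y < x + ε := by
    rw [Metric.mem_ball, Real.dist_eq] at hy
    linarith [(abs_lt.1 hy).2]
  have hka : x + ε < k * a := by
    have h1 : (N : ℝ) ≤ k := by exact_mod_cast (Nat.le_succ N).trans hkN
    calc x + ε < N * a := (div_lt_iff₀ ha).1 hN
      _ ≤ k * a := by gcongr
  have hz0 : z < 0 := by
    by_contra h
    have : (0 : ℝ) ≤ z := by exact_mod_cast not_lt.1 h
    nlinarith
  obtain ⟨l, hl⟩ := Int.eq_ofNat_of_zero_le (show 0 ≤ -z - 1 by omega)
  have hl' : (l : ℝ) + 1 = -z := by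
    have : (l : ℤ) + 1 = -z := by omega
    exact_mod_cast this
  have hk' : ((k - 1 : ℕ) : ℝ) + 1 = k := by
    rw [Nat.cast_sub (by omega)]
    simp
  refine ⟨k - 1, l, ?_⟩
  rw [hl', hk']
  convert! hy using 1
  linarith

/-- If `log a / log b` is irrational, then the products `c aᵏ bˡ` with `k, l ≥ 1` are dense in the
positive reals. -/
theorem exists_mul_pow_mul_pow_mem {a b : ℝ} (ha : 1 < a) (hb0 : 0 < b) (hb1 : b < 1)
    (hab : Irrational (Real.log a / Real.log b)) {c β : ℝ} (hc : 0 < c) (hβ : 0 < β)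
    {V : Set ℝ} (hV : V ∈ nhds β) : ∃ k l : ℕ, c * a ^ (k + 1) * b ^ (l + 1) ∈ V := by
  have hcont : Continuous fun x : ℝ => c * Real.exp x := by fun_prop
  have hx : c * Real.exp (Real.log (β / c)) = β := by
    rw [Real.exp_log (by positivity)]
    field_simp
  have hV' : (fun x : ℝ => c * Real.exp x) ⁻¹' V ∈ nhds (Real.log (β / c)) :=
    hcont.continuousAt (by rwa [hx])
  obtain ⟨ε, hε, hball⟩ := Metric.mem_nhds_iff.1 hV'
  obtain ⟨k, l, hkl⟩ := exists_nat_combination_near (Real.log_pos ha) (Real.log_neg hb0 hb1) hab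
    (Real.log (β / c)) hε
  refine ⟨k, l, ?_⟩
  have h := hball hkl
  rw [mem_preimage, Real.exp_add, ← mul_assoc] at h
  have hpow : ∀ (y : ℝ) (j : ℕ), 0 < y → Real.exp ((j + 1) * Real.log y) = y ^ (j + 1) := by
    intro y j hy
    rw [← Real.rpow_natCast, Real.rpow_def_of_pos hy, mul_comm]
    push_cast
    rfl
  rwa [hpow a k (by linarith), hpow b l hb0] at h

/-- Every interval to the right of a number `> 1` contains a number whose logarithm is
incommensurable with `log b`. -/
theorem exists_irrational_log_div_log {α δ b : ℝ} (hα : 1 < α) (hδ : 0 < δ) (hb0 : 0 < b)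
    (hb1 : b < 1) : ∃ a ∈ Ioo α (α + δ), Irrational (Real.log a / Real.log b) := by
  have hlb := Real.log_neg hb0 hb1
  obtain ⟨q, hq, h1, h2⟩ := exists_irrational_btwn
    (div_lt_div_of_neg_of_lt hlb (Real.log_lt_log (by linarith) (show α < α + δ by linarith)))
  refine ⟨Real.exp (q * Real.log b), ⟨?_, ?_⟩, ?_⟩
  · rw [← Real.log_lt_iff_lt_exp (by linarith)]
    exact (lt_div_iff_of_neg hlb).1 h2
  · rw [← Real.lt_log_iff_exp_lt (by linarith)]
    exact (div_lt_iff_of_neg hlb).1 h1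
  · rwa [Real.log_exp, mul_div_assoc, div_self hlb.ne, mul_one]

/-! ### Control sets on the sphere and their cones -/

section Cones

variable {n m : ℕ} {A : Matrix (Fin n) (Fin n) ℝ} {B : Fin m → Matrix (Fin n) (Fin n) ℝ}
  {Ω : Set (EuclideanSpace ℝ (Fin m))} {D : Set (Metric.sphere (0 : EuclideanSpace ℝ (Fin n)) 1)}

/-- Exact controllability: by local accessibility in `y ∈ int D`, the points that are steered to
`y` in small time contain an open subset of `D`, and approximate controllability reaches this
open set. In `ℝⁿ` the ray of `y` is reached. -/
theorem exists_smul_mem_posOrbit_of_mem_interior (hΩ : IsCompact Ω)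
    (hD : (sphereSystem A B Ω).IsApproxControllable D)
    {x y : Metric.sphere (0 : EuclideanSpace ℝ (Fin n)) 1} (hx : x ∈ D) (hy : y ∈ interior D)
    (hacc : (sphereSystem A B Ω).LocallyAccessibleAt y) :
    ∃ c : ℝ, 0 < c ∧ c • (y : EuclideanSpace ℝ (Fin n)) ∈
      (bilinearSystem A B Ω).posOrbit (x : EuclideanSpace ℝ (Fin n)) := by
  obtain ⟨ρ, hρ, hball⟩ := Metric.isOpen_iff.1 isOpen_interior y hy
  obtain ⟨L, hL⟩ := exists_sphere_speed_bound (A := A) (B := B) hΩ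
  -- in time `T` a trajectory stays in the ball of radius `ρ` around its end point `y`
  set T : ℝ := ρ / (|L| + 1) with hT
  have hT0 : 0 < T := by positivity
  have hLT : |L| * T < ρ := by
    rw [hT, mul_div_assoc', div_lt_iff₀ (by positivity)]
    linarith
  obtain ⟨w, hw⟩ := (hacc T hT0).2
  have hsub : (sphereSystem A B Ω).negOrbitLE T y ⊆ D := by
    rintro z ⟨t, ht0, htT, u, hu, ξ, hξ, rfl, rfl⟩
    refine interior_subset (hball ?_)
    rw [Metric.mem_ball, dist_comm]
    calc dist (ξ t) (ξ 0) ≤ L * t := hL u hu ξ hξ t ht0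
      _ ≤ |L| * T := by gcongr; exact le_abs_self L
      _ < ρ := hLT
  obtain ⟨z, hz, hxz⟩ := mem_closure_iff.1 (hD.2 x hx (hsub (interior_subset hw))) _
    isOpen_interior hw
  have hzy : y ∈ (sphereSystem A B Ω).posOrbit z := by
    obtain ⟨t, ht0, -, h⟩ := interior_subset hz
    exact ControlAffineSystem.mem_posOrbit_iff.2 ⟨t, ht0, h⟩
  obtain ⟨c, hc, h1⟩ := exists_smul_mem_posOrbit hΩ hxz
  obtain ⟨d, hd, h2⟩ := exists_smul_mem_posOrbit hΩ hzy
  refine ⟨c * d, by positivity, posOrbit_trans hΩ h1 ?_⟩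
  rw [mul_smul]
  exact mem_posOrbit_smul h2 c

theorem isOpen_cone_interior : IsOpen {x : EuclideanSpace ℝ (Fin n) |
    ∃ α : ℝ, 0 < α ∧ ∃ s ∈ interior D, x = α • (s : EuclideanSpace ℝ (Fin n))} := by
  obtain ⟨W, hW, hWD⟩ := isOpen_induced_iff.1 (isOpen_interior (s := D))
  have hopen : IsOpen ({x : EuclideanSpace ℝ (Fin n) | x ≠ 0} ∩ (fun x => ‖x‖⁻¹ • x) ⁻¹' W) :=
    ContinuousOn.isOpen_inter_preimage
      ((continuous_norm.continuousOn.inv₀ fun x hx => norm_ne_zero_iff.2 hx).smul continuousOn_id)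
      isOpen_ne hW
  convert! hopen using 1
  ext x
  constructor
  · rintro ⟨α, hα, s, hs, rfl⟩
    refine ⟨smul_ne_zero hα.ne' (ne_zero_of_mem_unit_sphere s), ?_⟩
    rw [mem_preimage, norm_inv_smul_smul_sphere hα]
    rw [← hWD] at hs
    exact hs
  · rintro ⟨hx, hxW⟩
    have hn : ‖x‖ ≠ 0 := norm_ne_zero_iff.2 hx
    refine ⟨‖x‖, norm_pos_iff.2 hx, ⟨‖x‖⁻¹ • x, norm_inv_smul_mem_sphere hx⟩, ?_, ?_⟩
    · rw [← hWD]
      exact hxW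
    · rw [smul_smul, mul_inv_cancel₀ hn, one_smul]

theorem nonempty_interior_coneOver (hD : (interior D).Nonempty) :
    (interior (coneOver D)).Nonempty := by
  obtain ⟨s, hs⟩ := hD
  refine ⟨(s : EuclideanSpace ℝ (Fin n)), interior_maximal ?_ isOpen_cone_interior
    ⟨1, one_pos, s, hs, (one_smul _ _).symm⟩⟩
  rintro x ⟨α, hα, s, hs, rfl⟩
  exact ⟨α, hα, s, interior_subset hs, rfl⟩

theorem ne_zero_of_mem_coneOver {x : EuclideanSpace ℝ (Fin n)} (hx : x ∈ coneOver D) : x ≠ 0 := by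
  obtain ⟨α, hα, s, -, rfl⟩ := hx
  exact smul_ne_zero hα.ne' (ne_zero_of_mem_unit_sphere s)

/-- From every point of the cone one can stay in the cone. -/
theorem exists_solution_mem_coneOver (hΩ : IsCompact Ω)
    (hD : (sphereSystem A B Ω).IsApproxControllable D) {x : EuclideanSpace ℝ (Fin n)}
    (hx : x ∈ coneOver D) : ∃ u, (bilinearSystem A B Ω).Admissible u ∧
      ∃ ξ, (bilinearSystem A B Ω).IsSolution u ξ ∧ ξ 0 = x ∧ ∀ t ≥ 0, ξ t ∈ coneOver D := by
  obtain ⟨α, hα, s, hs, rfl⟩ := hx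
  obtain ⟨u, hu, ξ, hξ, rfl, hstay⟩ := hD.1 s hs
  obtain ⟨r, hr, hr0, hsol⟩ := exists_bilinear_solution_of_sphere hΩ hu hξ
  refine ⟨u, hu, _, hsol.smul α, by simp [hr0], fun t ht => ?_⟩
  exact ⟨α * r t, mul_pos hα (hr t), ξ t, hstay t ht, (mul_smul _ _ _).symm⟩

/-- Approximate controllability on the cone, given an expanding and a contracting loop over `D`
whose multipliers have incommensurable logarithms: run through the loops sufficiently often to
adjust the radius. -/
theorem coneOver_subset_closure_posOrbit (hΩ : IsCompact Ω)
    (hD : (sphereSystem A B Ω).IsApproxControllable D)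
    (hacc : ∀ s ∈ interior D, (sphereSystem A B Ω).LocallyAccessibleAt s)
    {a b : ℝ} (ha : 1 < a) (hb0 : 0 < b) (hb1 : b < 1)
    (hab : Irrational (Real.log a / Real.log b))
    {p q : Metric.sphere (0 : EuclideanSpace ℝ (Fin n)) 1} (hp : p ∈ interior D)
    (hq : q ∈ interior D)
    (hpa : a • (p : EuclideanSpace ℝ (Fin n)) ∈ (bilinearSystem A B Ω).posOrbit (p : _))
    (hqb : b • (q : EuclideanSpace ℝ (Fin n)) ∈ (bilinearSystem A B Ω).posOrbit (q : _))
    {x : EuclideanSpace ℝ (Fin n)} (hx : x ∈ coneOver D) :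
    coneOver D ⊆ closure ((bilinearSystem A B Ω).posOrbit x) := by
  rintro y ⟨β, hβ, s', hs', rfl⟩
  obtain ⟨α, hα, s, hs, rfl⟩ := hx
  rw [mem_closure_iff]
  intro U hU hyU
  -- a point of the sphere that is exactly reachable from `q` and near `s'`
  have hcont : Continuous fun z : Metric.sphere (0 : EuclideanSpace ℝ (Fin n)) 1 =>
      β • (z : EuclideanSpace ℝ (Fin n)) := by fun_prop
  obtain ⟨z, hzU, hqz⟩ := mem_closure_iff.1 (hD.2 q (interior_subset hq) hs') _
    (hU.preimage hcont) hyU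
  obtain ⟨c₁, hc₁, h₁⟩ := exists_smul_mem_posOrbit_of_mem_interior hΩ hD hs hp (hacc p hp)
  obtain ⟨c₂, hc₂, h₂⟩ := exists_smul_mem_posOrbit_of_mem_interior hΩ hD (interior_subset hp) hq
    (hacc q hq)
  obtain ⟨c₃, hc₃, h₃⟩ := exists_smul_mem_posOrbit hΩ hqz
  have hcont' : Continuous fun r : ℝ => r • (z : EuclideanSpace ℝ (Fin n)) := by fun_prop
  obtain ⟨k, l, hkl⟩ := exists_mul_pow_mul_pow_mem ha hb0 hb1 hab
    (c := α * c₁ * c₂ * c₃) (by positivity) hβ ((hU.preimage hcont').mem_nhds hzU)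
  refine ⟨_, hkl, ?_⟩
  -- from `s` to the ray of `p`, `k + 1` expanding loops, to the ray of `q`, `l + 1` contracting
  -- loops, to the ray of `z`
  have e₁ := mem_posOrbit_smul h₁ α
  have e₂ := mem_posOrbit_smul (mem_posOrbit_smul (pow_smul_mem_posOrbit hΩ hpa k) c₁) α
  have e₃ := mem_posOrbit_smul (mem_posOrbit_smul (mem_posOrbit_smul h₂ (a ^ (k + 1))) c₁) α
  have e₄ := mem_posOrbit_smul (pow_smul_mem_posOrbit hΩ hqb l) (α * (c₁ * (a ^ (k + 1) * c₂)))
  have e₅ := mem_posOrbit_smul h₃ (α * (c₁ * (a ^ (k + 1) * c₂)) * b ^ (l + 1))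
  simp only [smul_smul, ← mul_assoc] at e₁ e₂ e₃ e₄ e₅
  have e := posOrbit_trans hΩ (posOrbit_trans hΩ (posOrbit_trans hΩ (posOrbit_trans hΩ e₁ e₂)
    e₃) e₄) e₅
  convert! e using 2
  ring

/-- Projecting a larger approximately controllable set to the sphere shows that the cone over a
control set is maximal; the origin is excluded since it cannot be left. -/
theorem subset_coneOver_of_isApproxControllable (hΩ : IsCompact Ω)
    (hD : (sphereSystem A B Ω).IsControlSet D) {K : Set (EuclideanSpace ℝ (Fin n))}
    (hDK : coneOver D ⊆ K) (hK : (bilinearSystem A B Ω).IsApproxControllable K) :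
    K ⊆ coneOver D := by
  obtain ⟨⟨s₀, hs₀⟩, -, hmax⟩ := hD
  have h0 : (0 : EuclideanSpace ℝ (Fin n)) ∉ K := by
    intro h
    have hmem : (s₀ : EuclideanSpace ℝ (Fin n)) ∈ coneOver D :=
      ⟨1, one_pos, s₀, hs₀, (one_smul _ _).symm⟩
    have hcl := closure_mono (posOrbit_zero_subset hΩ) (hK.2 0 h (hDK hmem))
    rw [closure_singleton] at hcl
    exact ne_zero_of_mem_coneOver hmem hcl
  set P : Set (Metric.sphere (0 : EuclideanSpace ℝ (Fin n)) 1) :=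
    {s | ∃ α : ℝ, 0 < α ∧ α • (s : EuclideanSpace ℝ (Fin n)) ∈ K} with hP
  have hDP : D ⊆ P := fun s hs => ⟨1, one_pos, hDK ⟨1, one_pos, s, hs, rfl⟩⟩
  have hPc : (sphereSystem A B Ω).IsApproxControllable P := by
    constructor
    · rintro s ⟨α, hα, hsK⟩
      obtain ⟨u, hu, ξ, hξ, h0ξ, hstay⟩ := hK.1 _ hsK
      obtain ⟨η, hη, hηξ⟩ := exists_sphere_solution_of_bilinear hΩ hu hξ fun h =>
        h0 (h ▸ h0ξ ▸ hsK)
      refine ⟨u, hu, η, hη, ?_, fun t ht => ?_⟩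
      · ext1
        rw [hηξ, h0ξ, norm_inv_smul_smul_sphere hα]
      · have hne : ξ t ≠ 0 := fun h => h0 (h ▸ hstay t ht)
        refine ⟨‖ξ t‖, norm_pos_iff.2 hne, ?_⟩
        rw [hηξ, smul_smul, mul_inv_cancel₀ (norm_ne_zero_iff.2 hne), one_smul]
        exact hstay t ht
    · rintro s ⟨α, hα, hsK⟩ s' ⟨α', hα', hsK'⟩
      rw [mem_closure_iff]
      intro U hU hsU
      obtain ⟨y, ⟨r, hr, z, hz, rfl⟩, hy⟩ := mem_closure_iff.1 (hK.2 _ hsK hsK') _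
        (isOpen_cone_interior (D := U)) ⟨α', hα', s', by rwa [hU.interior_eq], rfl⟩
      obtain ⟨z', hz', hzz'⟩ := mem_posOrbit_sphere hΩ hα hy
      obtain rfl : z' = z := by
        ext1
        rw [hzz', norm_inv_smul_smul_sphere hr]
      exact ⟨z', interior_subset hz, hz'⟩
  have hPD := hmax P hDP hPc
  intro y hy
  have hne : y ≠ 0 := fun h => h0 (h ▸ hy)
  have hn := norm_ne_zero_iff.2 hne
  have hyy : ‖y‖ • ‖y‖⁻¹ • y = y := by rw [smul_smul, mul_inv_cancel₀ hn, one_smul]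
  refine ⟨‖y‖, norm_pos_iff.2 hne, ⟨‖y‖⁻¹ • y, norm_inv_smul_mem_sphere hne⟩, ?_, hyy.symm⟩
  rw [← hPD]
  refine ⟨‖y‖, norm_pos_iff.2 hne, ?_⟩
  rw [hyy]
  exact hy

end Cones

theorem theorem3p2 {n m : ℕ} (A : Matrix (Fin n) (Fin n) ℝ)
    (B : Fin m → Matrix (Fin n) (Fin n) ℝ) (Ω : Set (EuclideanSpace ℝ (Fin m)))
    (hΩ : IsCompact Ω)
    (D : Set (Metric.sphere (0 : EuclideanSpace ℝ (Fin n)) 1))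
    (hD : (sphereSystem A B Ω).IsControlSet D)
    (hDint : (interior D).Nonempty)
    (hacc : ∀ s ∈ interior D, (sphereSystem A B Ω).LocallyAccessibleAt s)
    (hgrowth : ∃ α₀ > (1 : ℝ), ∃ δ₀ > (0 : ℝ), ∃ αm ∈ Set.Ioo (0 : ℝ) 1,
      ∀ αp ∈ Set.Ioo α₀ (α₀ + δ₀),
        ∃ sp ∈ interior D, ∃ sm ∈ interior D,
        ∃ up um : ℝ → EuclideanSpace ℝ (Fin m),
          (bilinearSystem A B Ω).Admissible up ∧ (bilinearSystem A B Ω).Admissible um ∧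
        ∃ σp > (0 : ℝ), ∃ σm > (0 : ℝ),
          (bilinearSystem A B Ω).Steers up σp sp (αp • (sp : EuclideanSpace ℝ (Fin n))) ∧
          (bilinearSystem A B Ω).Steers um σm sm (αm • (sm : EuclideanSpace ℝ (Fin n)))) :
    (bilinearSystem A B Ω).IsControlSet (coneOver D) ∧ (interior (coneOver D)).Nonempty := by
  obtain ⟨α₀, hα₀, δ₀, hδ₀, b, ⟨hb0, hb1⟩, hloops⟩ := hgrowth
  -- the freedom in the expanding multiplier is used to make the logarithms incommensurable
  obtain ⟨a, ha, hab⟩ := exists_irrational_log_div_log hα₀ hδ₀ hb0 hb1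
  obtain ⟨p, hp, q, hq, u, v, hu, hv, σ, hσ, τ, hτ, hpa, hqb⟩ := hloops a ha
  refine ⟨⟨?_, ⟨fun x hx => exists_solution_mem_coneOver hΩ hD.2.1 hx, fun x hx =>
    coneOver_subset_closure_posOrbit hΩ hD.2.1 hacc (hα₀.trans ha.1) hb0 hb1 hab hp hq
      (ControlAffineSystem.mem_posOrbit_iff.2 ⟨σ, hσ.le, u, hu, hpa⟩)
      (ControlAffineSystem.mem_posOrbit_iff.2 ⟨τ, hτ.le, v, hv, hqb⟩) hx⟩,
    fun K hDK hK => (subset_coneOver_of_isApproxControllable hΩ hD hDK hK).antisymm hDK⟩,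
    nonempty_interior_coneOver hDint⟩
  exact (nonempty_interior_coneOver hDint).mono interior_subset
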